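/- Let $N\ge 1$, $\beta\in(0,\pi/2)$, $0<p\le 1$, and let $\psi_0\in\mathbb{C}^2$ be a unit vector. Consider the quantum walk on the $N$-cycle with decoherence rate $p$, i.e. on $\mathbb{C}^N\otimes\mathbb{C}^2$ with orthonormal basis $|x\rangle\otimes|j\rangle$, $x\in\mathbb{Z}_N$, $j\in\{1,2\}$. Its evolution operator is $U=S(I\otimes U_c)$, where $$U_c=\begin{pmatrix}\cos\beta&\sin\beta\\ \sin\beta&-\cos\beta\end{pmatrix},\qquad S|x\rangle|1\rangle=|x+1\rangle|1\rangle,\quad S|x\rangle|2\rangle=|x-1\rangle|2\rangle ,$$ and its density operator is given by $\rho(0)=|0\rangle\langle 0|\otimes|\psi_0\rangle\langle\psi_0|$ and $$\rho(t+1)=\sum_{n=0}^{2}U(I\otimes A_n)\rho(t)(I\otimes A_n)^\dagger U^\dagger,$$ with $A_0=\sqrt{1-p}\,I$, $A_1=\tfrac{\sqrt p}{2}(I+\sigma_z)$, $A_2=\tfrac{\sqrt p}{2}(I-\sigma_z)$, $\sigma_z=\mathrm{diag}(1,-1)$. Let $\rho_c(t)$ (the coin) and $\rho_w(t)$ (the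 walker) be the partial traces of $\rho(t)$ over the walker and over the coin, respectively. For a real number $b>1$ write $S_b(\sigma)=-\mathrm{Tr}(\sigma\log_b\sigma)$ for the von Neumann entropy in base $b$ (with $0\log_b 0=0$), and call a positive semidefinite matrix of trace $1$ a state. Then, for every $b>1$: (i) $\lim_{t\to\infty}S_b(\rho_c(t))=\log_b 2$; in particular, $\lim_{t\to\infty}S_2(\rho_c(t))=1$. (ii) If $N$ is odd, then $\lim_{t\to\infty}S_b(\rho_w(t))=\log_b N$; in particular, the limit is $\ln N$ for natural logarithms. (iii) If $N$ is even, then $\lim_{t\to\infty}S_b(\rho_w(t))=\log_b\frac N2$; in particular, the limit is $\ln\frac N2$ for natural logarithms. These limits are the maximal values of the entropies. For every $t$, $\rho_c(t)$ is a state on $\mathbb{C}^2$ and $\rho_w(t)$ is a state on $\mathbb{C}^N$, and for even $N$ the state $\rho_w(t)$ is supported on the span of the $|x\rangle$, $0\le x\le N-1$, with $t-x$ even. The maximum of $S_b$ over the states on $\mathbb{C}^2$ is $\log_b 2$; for odd $N$, its maximum over the states on $\mathbb{C}^N$ is $\log_b N$; for even $N$ and every $t$, its maximum over the states on $\mathbb{C}^N$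 supported on the span of the $|x\rangle$, $0\le x\le N-1$, with $t-x$ even is $\log_b\frac N2$. -/

import Mathlib

open Filter Topology Set
open scoped Kronecker ComplexOrder

namespace CycleWalk

noncomputable section

/-- The coin operator `U_c(β)` on the coin space `ℂ²`. -/
def coin (β : ℝ) : Matrix (Fin 2) (Fin 2) ℂ :=
  !![(Real.cos β : ℂ), (Real.sin β : ℂ); (Real.sin β : ℂ), -(Real.cos β : ℂ)]

/-- The displacement prescribed by a coin basis state: the first one moves the walker by `+1`,
the second one by `-1`. -/
def step (N : ℕ) (j : Fin 2) : ZMod N :=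
  if j = 0 then 1 else -1

/-- The conditional shift on `ℂ^N ⊗ ℂ²`, that is `|x⟩ ⊗ |j⟩ ↦ |x + step j⟩ ⊗ |j⟩`, as a matrix:
the row index is the output basis vector, the column index the input basis vector. -/
def shift (N : ℕ) : Matrix (ZMod N × Fin 2) (ZMod N × Fin 2) ℂ :=
  Matrix.of fun a b => if a.1 = b.1 + step N b.2 ∧ a.2 = b.2 then 1 else 0

/-- The one-step evolution operator `U = S (I ⊗ U_c)`. -/
def evolution (N : ℕ) [NeZero N] (β : ℝ) : Matrix (ZMod N × Fin 2) (ZMod N × Fin 2) ℂ :=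
  shift N * ((1 : Matrix (ZMod N) (ZMod N) ℂ) ⊗ₖ coin β)

/-- The Pauli matrix `σ_z`. -/
def sigmaZ : Matrix (Fin 2) (Fin 2) ℂ := !![1, 0; 0, -1]

/-- The three decoherence operators on the coin space, `√(1-p) σ₀`, `(√p / 2) (σ₀ + σ_z)` and
`(√p / 2) (σ₀ - σ_z)`: the coin is measured with probability `p`. -/
def kraus (p : ℝ) : Fin 3 → Matrix (Fin 2) (Fin 2) ℂ :=
  ![(Real.sqrt (1 - p) : ℂ) • 1,
    ((Real.sqrt p / 2 : ℝ) : ℂ) • (1 + sigmaZ),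
    ((Real.sqrt p / 2 : ℝ) : ℂ) • (1 - sigmaZ)]

/-- The density matrix `|0⟩⟨0| ⊗ |ψ₀⟩⟨ψ₀|` of a walk launched from the origin. -/
def initialDensity (N : ℕ) (ψ₀ : EuclideanSpace ℂ (Fin 2)) :
    Matrix (ZMod N × Fin 2) (ZMod N × Fin 2) ℂ :=
  Matrix.single (0 : ZMod N) (0 : ZMod N) (1 : ℂ) ⊗ₖ
    Matrix.of fun j l : Fin 2 => ψ₀ j * star (ψ₀ l)

/-- The total density operator `ρ(t)`:
`ρ(t+1) = ∑ₙ U (I ⊗ Aₙ) ρ(t) (I ⊗ Aₙ)† U†`. -/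
def density (N : ℕ) [NeZero N] (β p : ℝ) (ψ₀ : EuclideanSpace ℂ (Fin 2)) :
    ℕ → Matrix (ZMod N × Fin 2) (ZMod N × Fin 2) ℂ
  | 0 => initialDensity N ψ₀
  | t + 1 => ∑ n : Fin 3,
      evolution N β * ((1 : Matrix (ZMod N) (ZMod N) ℂ) ⊗ₖ kraus p n) *
        density N β p ψ₀ t *
        ((1 : Matrix (ZMod N) (ZMod N) ℂ) ⊗ₖ kraus p n).conjTranspose *
        (evolution N β).conjTranspose

/-- The reduced density operator of the coin: the walker is traced out. -/
def coinDensity (N : ℕ) [NeZero N] (β p : ℝ) (ψ₀ : EuclideanSpace ℂ (Fin 2)) (t : ℕ) :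
    Matrix (Fin 2) (Fin 2) ℂ :=
  Matrix.of fun j l => ∑ x : ZMod N, density N β p ψ₀ t (x, j) (x, l)

/-- The reduced density operator of the walker: the coin is traced out. -/
def walkerDensity (N : ℕ) [NeZero N] (β p : ℝ) (ψ₀ : EuclideanSpace ℂ (Fin 2)) (t : ℕ) :
    Matrix (ZMod N) (ZMod N) ℂ :=
  Matrix.of fun x y => ∑ j : Fin 2, density N β p ψ₀ t (x, j) (y, j)

/-- The von Neumann entropy `-Tr (ρ log_b ρ)` with logarithms to base `b`; the logarithm of the
matrix is taken by functional calculus, and `0 log 0 = 0`. -/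
def entropy (b : ℝ) {n : Type*} [Fintype n] [DecidableEq n] (ρ : Matrix n n ℂ) : ℝ :=
  -(Matrix.trace (ρ * cfc (Real.logb b) ρ)).re

/-- The set of density matrices (states): positive semidefinite of trace one. -/
def states (n : Type*) [Fintype n] : Set (Matrix n n ℂ) :=
  {σ | σ.PosSemidef ∧ σ.trace = 1}

/-- The states of the walker supported on the nodes `x ∈ {0, …, N-1}` for which `t - x` is even. -/
def parityStates (N : ℕ) [NeZero N] (t : ℕ) : Set (Matrix (ZMod N) (ZMod N) ℂ) :=
  {σ ∈ states (ZMod N) |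
    ∀ x y : ZMod N, ¬ (Even ((t : ℤ) - x.val) ∧ Even ((t : ℤ) - y.val)) → σ x y = 0}

end

end CycleWalk

/-!
The purity `Tr ρ(t)²` never increases: the evolution is unitary, and the decoherence multiplies the
coin-off-diagonal blocks of `ρ(t)` by `1 - p` and keeps the diagonal ones
(`purity_density_succ`). Being bounded below, the purity converges, so its decrements tend to zero,
and with them the off-diagonal blocks. As `ρ(t)` obeys a linear recursion, this propagates. The
off-diagonal block at time `t + 1` contains `cos β sin β` times the difference of the two diagonal
blocks at time `t`, hence these merge (`tendsto_diag_sub`). One step moves one of them forward and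
the other backward, hence their sum, the walker's density operator `w(t)`, becomes invariant under
translation by `2` (`tendsto_walkerDensity_sub`).

The sum of `w(t)` along each cyclic diagonal is conserved, and equals `1` on the main diagonal and
`0` on the others (`sum_walkerDensity_add`). For odd `N`, translations by `2` act transitively, so
`w(t)` approaches the maximally mixed state. For even `N` they preserve the parity class of a node, and `w(t)` is
supported on the class of `t`, so it approaches the uniform state on a class of `N / 2` nodes that
alternates with `t`. In both cases, and for the coin, the purity tends to `1 / m`, with `m` the
number of available basis vectors.

This determines the limit of the entropy without any continuity argument. A state of rank at most
`m` has entropy at most `log m` (`entropy_le_logb_of_rank_le`), while the entropy is at least minus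
the logarithm of the purity (`neg_logb_purity_le_entropy`); both bounds come from `log x ≤ x - 1`
applied to the eigenvalues. The two bounds meet at the uniform state, which also gives the
maximal values of the entropy.
-/

namespace CycleWalk

/-! ### Entropy, purity and rank -/

section Entropy

variable {n : Type*} [Fintype n] [DecidableEq n] {σ : Matrix n n ℂ}

theorem trace_mul_cfc (hσ : σ.IsHermitian) (f : ℝ → ℝ) :
    (σ * cfc f σ).trace = ((∑ i, hσ.eigenvalues i * f (hσ.eigenvalues i) : ℝ) : ℂ) := by
  have h : σ * cfc f σ = Unitary.conjStarAlgAut ℂ _ hσ.eigenvectorUnitary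
      (Matrix.diagonal fun i => ((hσ.eigenvalues i * f (hσ.eigenvalues i) : ℝ) : ℂ)) := by
    conv_lhs => rw [hσ.cfc_eq, Matrix.IsHermitian.cfc]
    conv_lhs => enter [1]; rw [hσ.spectral_theorem]
    rw [← map_mul, Matrix.diagonal_mul_diagonal]
    congr 2
    ext i
    simp
  rw [h, Unitary.conjStarAlgAut_apply, Matrix.trace_mul_comm, ← mul_assoc]
  simp [Matrix.trace_diagonal]

theorem entropy_eq_sum (b : ℝ) (hσ : σ.IsHermitian) :
    entropy b σ = (∑ i, -(hσ.eigenvalues i * Real.log (hσ.eigenvalues i))) / Real.log b := by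
  rw [entropy, trace_mul_cfc hσ, Complex.ofReal_re, Finset.sum_div, ← Finset.sum_neg_distrib]
  refine Finset.sum_congr rfl fun i _ => ?_
  rw [Real.logb]
  ring

theorem trace_mul_self_eq (hσ : σ.IsHermitian) :
    (σ * σ).trace = ((∑ i, hσ.eigenvalues i ^ 2 : ℝ) : ℂ) := by
  have h := trace_mul_cfc hσ id
  rw [cfc_id ℝ σ (show IsSelfAdjoint σ from hσ)] at h
  simpa [sq] using h

/-- The purity `Tr σ²` of a Hermitian matrix, written as its squared Hilbert-Schmidt norm. -/
noncomputable def purity (σ : Matrix n n ℂ) : ℝ := ∑ x, ∑ y, ‖σ x y‖ ^ 2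

theorem purity_eq_sum_eigenvalues (hσ : σ.IsHermitian) :
    purity σ = ∑ i, hσ.eigenvalues i ^ 2 := by
  have h := trace_mul_self_eq hσ
  have h' : (σ * σ).trace = ((purity σ : ℝ) : ℂ) := by
    simp only [Matrix.trace, Matrix.diag_apply, Matrix.mul_apply, purity, Complex.ofReal_sum]
    refine Finset.sum_congr rfl fun x _ => Finset.sum_congr rfl fun y _ => ?_
    rw [← hσ.apply y x, Complex.star_def, Complex.mul_conj, Complex.normSq_eq_norm_sq]
  exact_mod_cast h'.symm.trans h

theorem sum_eigenvalues_eq_one (hσ : σ ∈ states n) : ∑ i, hσ.1.1.eigenvalues i = 1 := by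
  have h := hσ.2.symm.trans hσ.1.1.trace_eq_sum_eigenvalues
  apply Complex.ofReal_injective
  rw [Complex.ofReal_sum, Complex.ofReal_one]
  exact h.symm

theorem purity_pos (hσ : σ ∈ states n) : 0 < purity σ := by
  rw [purity_eq_sum_eigenvalues hσ.1.1]
  refine (Finset.sum_nonneg fun i _ => sq_nonneg _).lt_of_ne fun h => ?_
  have h0 := (Finset.sum_eq_zero_iff_of_nonneg fun i _ => sq_nonneg _).1 h.symm
  have h1 := sum_eigenvalues_eq_one hσ
  rw [Finset.sum_eq_zero fun i hi => pow_eq_zero_iff two_ne_zero |>.1 (h0 i hi)] at h1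
  exact zero_ne_one h1

theorem purity_le_one (hσ : σ ∈ states n) : purity σ ≤ 1 := by
  rw [purity_eq_sum_eigenvalues hσ.1.1]
  have h := Finset.sum_sq_le_sq_sum_of_nonneg (s := Finset.univ) (f := hσ.1.1.eigenvalues)
    fun i _ => hσ.1.eigenvalues_nonneg i
  rwa [sum_eigenvalues_eq_one hσ, one_pow] at h

theorem norm_apply_le_one (hσ : σ ∈ states n) (x y : n) : ‖σ x y‖ ≤ 1 := by
  have h : ‖σ x y‖ ^ 2 ≤ purity σ :=
    (Finset.single_le_sum (f := fun y => ‖σ x y‖ ^ 2) (fun _ _ => sq_nonneg _)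
      (Finset.mem_univ y)).trans
    (Finset.single_le_sum (f := fun x => ∑ y, ‖σ x y‖ ^ 2)
      (fun _ _ => Finset.sum_nonneg fun _ _ => sq_nonneg _) (Finset.mem_univ x))
  exact (sq_le_one_iff₀ (norm_nonneg _)).1 (h.trans (purity_le_one hσ))

theorem tendsto_mul_of_states {w : ℕ → Matrix n n ℂ}
    (hw : ∀ t, w t ∈ states n) (x y : n) {f : ℕ → ℂ} (hf : Tendsto f atTop (𝓝 0)) :
    Tendsto (fun t => w t x y * f t) atTop (𝓝 0) := by
  refine squeeze_zero_norm (fun t => ?_) (tendsto_zero_iff_norm_tendsto_zero.1 hf)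
  rw [norm_mul]
  exact mul_le_of_le_one_left (norm_nonneg _) (norm_apply_le_one (hw t) x y)

/-- The von Neumann entropy is at least the Rényi entropy of order two: on each eigenvalue, bound
the logarithm by its tangent at the purity. -/
theorem neg_logb_purity_le_entropy {b : ℝ} (hb : 1 < b) (hσ : σ ∈ states n) :
    -Real.logb b (purity σ) ≤ entropy b σ := by
  rw [entropy_eq_sum b hσ.1.1, Real.logb, ← neg_div]
  refine div_le_div_of_nonneg_right ?_ (Real.log_pos hb).le
  have hP := purity_pos hσ
  have key : ∀ i, -(hσ.1.1.eigenvalues i * Real.log (purity σ) +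
      hσ.1.1.eigenvalues i ^ 2 / purity σ - hσ.1.1.eigenvalues i) ≤
      -(hσ.1.1.eigenvalues i * Real.log (hσ.1.1.eigenvalues i)) := by
    intro i
    rcases (hσ.1.eigenvalues_nonneg i).eq_or_lt' with h0 | h0
    · simp [h0]
    · have h := mul_le_mul_of_nonneg_left (Real.log_le_sub_one_of_pos (div_pos h0 hP)) h0.le
      rw [Real.log_div h0.ne' hP.ne'] at h
      have e : hσ.1.1.eigenvalues i * (hσ.1.1.eigenvalues i / purity σ - 1) =
        hσ.1.1.eigenvalues i ^ 2 / purity σ - hσ.1.1.eigenvalues i := by ring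
      linarith
  refine le_trans (le_of_eq ?_) (Finset.sum_le_sum fun i _ => key i)
  rw [Finset.sum_neg_distrib, Finset.sum_sub_distrib, Finset.sum_add_distrib, ← Finset.sum_mul,
    ← Finset.sum_div, ← purity_eq_sum_eigenvalues hσ.1.1, sum_eigenvalues_eq_one hσ,
    div_self hP.ne']
  ring

/-- The entropy of a state of rank at most `m` is at most `log m`: bound the logarithm of each
nonzero eigenvalue by its tangent at `1 / m`. -/
theorem entropy_le_logb_of_rank_le {b m : ℝ} (hb : 1 < b) (hm : 0 < m) (hσ : σ ∈ states n)
    (hr : (σ.rank : ℝ) ≤ m) : entropy b σ ≤ Real.logb b m := by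
  rw [entropy_eq_sum b hσ.1.1, Real.logb]
  refine div_le_div_of_nonneg_right ?_ (Real.log_pos hb).le
  have key : ∀ i, -(hσ.1.1.eigenvalues i * Real.log (hσ.1.1.eigenvalues i)) ≤
      hσ.1.1.eigenvalues i * Real.log m + (if hσ.1.1.eigenvalues i ≠ 0 then 1 else 0) / m -
        hσ.1.1.eigenvalues i := by
    intro i
    rcases (hσ.1.eigenvalues_nonneg i).eq_or_lt' with h0 | h0
    · simp [h0]
    · have h1 : 0 < m * hσ.1.1.eigenvalues i := mul_pos hm h0
      have h := mul_le_mul_of_nonneg_left (Real.log_le_sub_one_of_pos (inv_pos.2 h1)) h0.le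
      rw [Real.log_inv, Real.log_mul hm.ne' h0.ne'] at h
      have e : hσ.1.1.eigenvalues i * ((m * hσ.1.1.eigenvalues i)⁻¹ - 1) =
        1 / m - hσ.1.1.eigenvalues i := by field_simp
      rw [if_pos h0.ne']
      linarith
  refine (Finset.sum_le_sum fun i _ => key i).trans ?_
  rw [Finset.sum_sub_distrib, Finset.sum_add_distrib, ← Finset.sum_mul,
    ← Finset.sum_div, sum_eigenvalues_eq_one hσ, Finset.sum_boole, ← Fintype.card_subtype,
    ← hσ.1.1.rank_eq_card_non_zero_eigs]
  have := (div_le_one hm).2 hr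
  linarith

/-- A matrix whose nonzero rows are indexed by `s` has rank at most the size of `s`. -/
theorem rank_le_card_of_apply_eq_zero (s : Finset n) (h : ∀ x y, x ∉ s → σ x y = 0) :
    σ.rank ≤ s.card := by
  have e : σ = Matrix.diagonal (fun x => if x ∈ s then (1 : ℂ) else 0) * σ := by
    ext x y
    by_cases hx : x ∈ s <;> simp [Matrix.diagonal_mul, hx, h x y]
  rw [e]
  refine (Matrix.rank_mul_le_left _ _).trans ?_
  rw [Matrix.rank_diagonal, Fintype.card_subtype]
  simp

/-- The maximally mixed state on the span of the basis vectors in `s`. -/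
noncomputable def uniformState (s : Finset n) : Matrix n n ℂ :=
  Matrix.diagonal fun x => if x ∈ s then ((s.card : ℂ))⁻¹ else 0

theorem uniformState_mem_states {s : Finset n} (hs : s.Nonempty) : uniformState s ∈ states n := by
  refine ⟨Matrix.PosSemidef.diagonal fun x => ?_, ?_⟩
  · dsimp only
    split_ifs
    · simp
    · exact le_rfl
  · have : (s.card : ℂ) ≠ 0 := by exact_mod_cast hs.card_pos.ne'
    simp [uniformState, Matrix.trace_diagonal, Finset.sum_ite_mem, this]

theorem purity_uniformState {s : Finset n} (hs : s.Nonempty) :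
    purity (uniformState s) = ((s.card : ℝ))⁻¹ := by
  have h : ∀ x y, ‖uniformState s x y‖ ^ 2 =
      if x = y then (if x ∈ s then ((s.card : ℝ)⁻¹) ^ 2 else 0) else 0 := by
    intro x y
    by_cases hxy : x = y
    · subst hxy
      by_cases hx : x ∈ s <;> simp [uniformState, hx]
    · simp [uniformState, hxy]
  have hs' : (s.card : ℝ) ≠ 0 := by exact_mod_cast hs.card_pos.ne'
  simp only [purity, h, Finset.sum_ite_eq, Finset.mem_univ, if_true, Finset.sum_ite_mem,
    Finset.univ_inter, Finset.sum_const, nsmul_eq_mul]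
  field_simp

/-- Among the states supported on the span of the basis vectors in `s`, the maximal entropy is
the logarithm of the dimension. -/
theorem isGreatest_entropy_supported {b : ℝ} (hb : 1 < b) {s : Finset n} (hs : s.Nonempty)
    {A : Set (Matrix n n ℂ)}
    (hA : ∀ σ, σ ∈ A ↔ σ ∈ states n ∧ ∀ x y, ¬ (x ∈ s ∧ y ∈ s) → σ x y = 0) :
    IsGreatest (entropy b '' A) (Real.logb b s.card) := by
  have hs' : (0 : ℝ) < s.card := by exact_mod_cast hs.card_pos
  have hub : ∀ σ ∈ A, entropy b σ ≤ Real.logb b s.card := fun σ h =>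
    entropy_le_logb_of_rank_le hb hs' ((hA σ).1 h).1 (by
      exact_mod_cast rank_le_card_of_apply_eq_zero s fun x y hx =>
        ((hA σ).1 h).2 x y fun hxy => hx hxy.1)
  have hmem : uniformState s ∈ A := by
    refine (hA _).2 ⟨uniformState_mem_states hs, fun x y hxy => ?_⟩
    by_cases e : x = y
    · subst e
      have : x ∉ s := fun h => hxy ⟨h, h⟩
      simp [uniformState, this]
    · simp [uniformState, e]
  refine ⟨⟨_, hmem, (hub _ hmem).antisymm ?_⟩, ?_⟩
  · have h := neg_logb_purity_le_entropy hb (uniformState_mem_states hs)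
    rwa [purity_uniformState hs, Real.logb_inv, neg_neg] at h
  · rintro _ ⟨σ, h, rfl⟩
    exact hub σ h

theorem isGreatest_entropy_states [Nonempty n] {b : ℝ} (hb : 1 < b) :
    IsGreatest (entropy b '' states n) (Real.logb b (Fintype.card n)) :=
  isGreatest_entropy_supported hb (s := Finset.univ) Finset.univ_nonempty (by simp)

/-- States of rank at most `m` whose entries `z` satisfy `z (m z - δ) → 0`, where `δ` is the
Kronecker delta, have entropy tending to `log m`. The hypothesis does not force convergence: each
diagonal entry may oscillate between `0` and `1 / m`. It does force the purity to tend to `1 / m`,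
which bounds the entropy from below. -/
theorem tendsto_entropy {b m : ℝ} (hb : 1 < b) (hm : 0 < m) {w : ℕ → Matrix n n ℂ}
    (hw : ∀ t, w t ∈ states n) (hr : ∀ t, ((w t).rank : ℝ) ≤ m)
    (h : ∀ x y, Tendsto (fun t => w t x y * (m * w t x y - if x = y then 1 else 0)) atTop (𝓝 0)) :
    Tendsto (fun t => entropy b (w t)) atTop (𝓝 (Real.logb b m)) := by
  have hid : ∀ t, (m * purity (w t) - 1 : ℝ) =
      (∑ x, ∑ y, (starRingEnd ℂ) (w t x y) * (m * w t x y - if x = y then 1 else 0)).re := by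
    intro t
    have e : ∑ x, ∑ y, (starRingEnd ℂ) (w t x y) * (m * w t x y - if x = y then 1 else 0) =
        ((m * purity (w t) : ℝ) : ℂ) - (starRingEnd ℂ) (w t).trace := by
      simp only [mul_sub, Finset.sum_sub_distrib, mul_ite, mul_one, mul_zero, Finset.sum_ite_eq,
        Finset.mem_univ, if_true, Matrix.trace, Matrix.diag_apply, map_sum, purity,
        Complex.ofReal_mul, Complex.ofReal_sum, Finset.mul_sum]
      congr 1
      refine Finset.sum_congr rfl fun x _ => Finset.sum_congr rfl fun y _ => ?_
      rw [mul_left_comm, mul_comm ((starRingEnd ℂ) _), Complex.mul_conj,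
        Complex.normSq_eq_norm_sq]
    rw [e, (hw t).2]
    simp
  have hlim : Tendsto (fun t => m * purity (w t) - 1) atTop (𝓝 0) := by
    have h1 : Tendsto (fun t => ∑ x, ∑ y,
        (starRingEnd ℂ) (w t x y) * (m * w t x y - if x = y then 1 else 0)) atTop (𝓝 0) := by
      have h2 : ∀ x y, Tendsto (fun t => (starRingEnd ℂ) (w t x y) *
          (m * w t x y - if x = y then 1 else 0)) atTop (𝓝 0) := fun x y => by
        rw [tendsto_zero_iff_norm_tendsto_zero]
        simpa only [norm_mul, RCLike.norm_conj] using
          (tendsto_zero_iff_norm_tendsto_zero.1 (h x y))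
      simpa using tendsto_finsetSum (Finset.univ : Finset n) fun x _ =>
        tendsto_finsetSum (Finset.univ : Finset n) fun y _ => h2 x y
    simpa only [hid, Complex.zero_re, Function.comp_def] using
      (Complex.continuous_re.tendsto 0).comp h1
  have hpur : Tendsto (fun t => purity (w t)) atTop (𝓝 m⁻¹) := by
    have := ((hlim.add_const 1).const_mul m⁻¹)
    simpa [hm.ne'] using this
  have hlow : Tendsto (fun t => -Real.logb b (purity (w t))) atTop (𝓝 (Real.logb b m)) := by
    have := (hpur.log (inv_pos.2 hm).ne').div_const (Real.log b)
    have h3 := this.neg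
    rw [Real.log_inv, neg_div, neg_neg] at h3
    exact h3
  exact tendsto_of_tendsto_of_tendsto_of_le_of_le hlow tendsto_const_nhds
    (fun t => neg_logb_purity_le_entropy hb (hw t))
    (fun t => entropy_le_logb_of_rank_le hb hm (hw t) (hr t))

end Entropy

/-! ### The recursion for the entries of the density operator -/

section Recursion

variable {N : ℕ} [NeZero N] {β p : ℝ} {ψ₀ : EuclideanSpace ℂ (Fin 2)}

theorem evolution_mul_apply (A : Matrix (Fin 2) (Fin 2) ℂ) (x y : ZMod N) (j a : Fin 2) :
    (evolution N β * ((1 : Matrix (ZMod N) (ZMod N) ℂ) ⊗ₖ A)) (x, j) (y, a) =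
      if y = x - step N j then (coin β * A) j a else 0 := by
  rw [evolution, mul_assoc, ← Matrix.mul_kronecker_mul, one_mul, Matrix.mul_apply,
    Fintype.sum_prod_type, Finset.sum_eq_single y, Finset.sum_eq_single j]
  · simp [shift, Matrix.kroneckerMap_apply, eq_sub_iff_add_eq, eq_comm]
  · intro k _ hk
    simp [shift, hk.symm]
  · simp
  · intro z _ hz
    simp [Matrix.kroneckerMap_apply, hz]
  · simp

theorem mul_mul_conjTranspose_apply (A : Matrix (Fin 2) (Fin 2) ℂ)
    (ρ : Matrix (ZMod N × Fin 2) (ZMod N × Fin 2) ℂ) (x y : ZMod N) (j l : Fin 2) :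
    (evolution N β * ((1 : Matrix (ZMod N) (ZMod N) ℂ) ⊗ₖ A) * ρ *
      ((1 : Matrix (ZMod N) (ZMod N) ℂ) ⊗ₖ A).conjTranspose * (evolution N β).conjTranspose)
        (x, j) (y, l) =
      ∑ a, ∑ b, (coin β * A) j a * star ((coin β * A) l b) *
        ρ (x - step N j, a) (y - step N l, b) := by
  rw [mul_assoc _ (Matrix.conjTranspose _), ← Matrix.conjTranspose_mul, Matrix.mul_apply,
    Fintype.sum_prod_type, Finset.sum_eq_single (y - step N l)]
  · simp only [Matrix.conjTranspose_apply, evolution_mul_apply, if_true]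
    rw [Finset.sum_comm]
    refine Finset.sum_congr rfl fun b _ => ?_
    rw [Matrix.mul_apply, Fintype.sum_prod_type, Finset.sum_eq_single (x - step N j)]
    · simp only [evolution_mul_apply, if_true, Finset.sum_mul]
      exact Finset.sum_congr rfl fun a _ => by ring
    · intro z _ hz
      simp [evolution_mul_apply, hz]
    · simp
  · intro z _ hz
    simp [Matrix.conjTranspose_apply, evolution_mul_apply, hz]
  · simp

theorem star_coin_apply (j a : Fin 2) : star (coin β j a) = coin β j a := by
  fin_cases j <;> fin_cases a <;> simp [coin, -Complex.ofReal_cos, -Complex.ofReal_sin]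

/-- The diagonal of the `n`-th decoherence operator. -/
noncomputable def krausDiag (p : ℝ) (n : Fin 3) (a : Fin 2) : ℝ :=
  ![Real.sqrt (1 - p), if a = 0 then Real.sqrt p else 0, if a = 0 then 0 else Real.sqrt p] n

theorem kraus_eq_diagonal (n : Fin 3) :
    kraus p n = Matrix.diagonal fun a => (krausDiag p n a : ℂ) := by
  ext i j
  fin_cases n <;> fin_cases i <;> fin_cases j <;> simp [kraus, krausDiag, sigmaZ]
  all_goals ring

theorem sum_krausDiag_mul (hp0 : 0 ≤ p) (hp1 : p ≤ 1) (a b : Fin 2) :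
    ∑ n, krausDiag p n a * krausDiag p n b = if a = b then 1 else 1 - p := by
  have h1 := Real.mul_self_sqrt hp0
  have h2 := Real.mul_self_sqrt (sub_nonneg.2 hp1)
  fin_cases a <;> fin_cases b <;> simp [Fin.sum_univ_three, krausDiag, h1, h2]

/-- One step of the walk, entry by entry. The sum over the decoherence operators amounts to the
factor `1 - p` on the coin-off-diagonal entries. -/
theorem density_succ_apply (hp0 : 0 ≤ p) (hp1 : p ≤ 1) (t : ℕ) (x y : ZMod N) (j l : Fin 2) :
    density N β p ψ₀ (t + 1) (x, j) (y, l) = ∑ a, ∑ b, coin β j a * coin β l b *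
      ((if a = b then 1 else 1 - p : ℝ) : ℂ) *
        density N β p ψ₀ t (x - step N j, a) (y - step N l, b) := by
  simp only [density, Matrix.sum_apply, mul_mul_conjTranspose_apply]
  rw [Finset.sum_comm]
  refine Finset.sum_congr rfl fun a _ => ?_
  rw [Finset.sum_comm]
  refine Finset.sum_congr rfl fun b _ => ?_
  rw [← sum_krausDiag_mul hp0 hp1, Complex.ofReal_sum, Finset.mul_sum, Finset.sum_mul]
  refine Finset.sum_congr rfl fun n _ => ?_
  simp only [kraus_eq_diagonal, Matrix.mul_diagonal, star_mul', star_coin_apply,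
    Complex.star_def, Complex.conj_ofReal, Complex.ofReal_mul]
  ring

theorem density_succ_zero_zero (hp0 : 0 ≤ p) (hp1 : p ≤ 1) (t : ℕ) (x y : ZMod N) :
    density N β p ψ₀ (t + 1) (x + 1, 0) (y + 1, 0) =
      Real.cos β ^ 2 * density N β p ψ₀ t (x, 0) (y, 0) +
      Real.cos β * Real.sin β * (1 - p) *
        (density N β p ψ₀ t (x, 0) (y, 1) + density N β p ψ₀ t (x, 1) (y, 0)) +
      Real.sin β ^ 2 * density N β p ψ₀ t (x, 1) (y, 1) := by
  rw [density_succ_apply hp0 hp1]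
  simp [coin, step, -Complex.ofReal_cos, -Complex.ofReal_sin]
  ring

theorem density_succ_one_one (hp0 : 0 ≤ p) (hp1 : p ≤ 1) (t : ℕ) (x y : ZMod N) :
    density N β p ψ₀ (t + 1) (x - 1, 1) (y - 1, 1) =
      Real.sin β ^ 2 * density N β p ψ₀ t (x, 0) (y, 0) -
      Real.cos β * Real.sin β * (1 - p) *
        (density N β p ψ₀ t (x, 0) (y, 1) + density N β p ψ₀ t (x, 1) (y, 0)) +
      Real.cos β ^ 2 * density N β p ψ₀ t (x, 1) (y, 1) := by
  rw [density_succ_apply hp0 hp1]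
  simp [coin, step, -Complex.ofReal_cos, -Complex.ofReal_sin]
  ring

theorem density_succ_zero_one (hp0 : 0 ≤ p) (hp1 : p ≤ 1) (t : ℕ) (x y : ZMod N) :
    density N β p ψ₀ (t + 1) (x + 1, 0) (y - 1, 1) =
      Real.cos β * Real.sin β *
        (density N β p ψ₀ t (x, 0) (y, 0) - density N β p ψ₀ t (x, 1) (y, 1)) -
      Real.cos β ^ 2 * (1 - p) * density N β p ψ₀ t (x, 0) (y, 1) +
      Real.sin β ^ 2 * (1 - p) * density N β p ψ₀ t (x, 1) (y, 0) := by
  rw [density_succ_apply hp0 hp1]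
  simp [coin, step, -Complex.ofReal_cos, -Complex.ofReal_sin]
  ring

theorem density_succ_one_zero (hp0 : 0 ≤ p) (hp1 : p ≤ 1) (t : ℕ) (x y : ZMod N) :
    density N β p ψ₀ (t + 1) (x - 1, 1) (y + 1, 0) =
      Real.cos β * Real.sin β *
        (density N β p ψ₀ t (x, 0) (y, 0) - density N β p ψ₀ t (x, 1) (y, 1)) +
      Real.sin β ^ 2 * (1 - p) * density N β p ψ₀ t (x, 0) (y, 1) -
      Real.cos β ^ 2 * (1 - p) * density N β p ψ₀ t (x, 1) (y, 0) := by
  rw [density_succ_apply hp0 hp1]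
  simp [coin, step, -Complex.ofReal_cos, -Complex.ofReal_sin]
  ring

end Recursion

/-! ### States and conserved quantities -/

section Conserved

variable {N : ℕ} [NeZero N] {β p : ℝ} {ψ₀ : EuclideanSpace ℂ (Fin 2)}

theorem posSemidef_density (t : ℕ) : (density N β p ψ₀ t).PosSemidef := by
  induction t with
  | zero =>
    refine Matrix.PosSemidef.kronecker ?_ ?_
    · rw [show (Matrix.single (0 : ZMod N) (0 : ZMod N) (1 : ℂ)) =
        Matrix.diagonal (Pi.single 0 1) from (Matrix.diagonal_single 0 1).symm]
      refine Matrix.PosSemidef.diagonal fun x => ?_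
      by_cases hx : x = 0
      · subst hx; simp
      · simp [hx]
    · exact Matrix.posSemidef_vecMulVec_self_star (fun j => ψ₀ j)
  | succ t ih =>
    refine Matrix.posSemidef_sum _ fun n _ => ?_
    have := ih.mul_mul_conjTranspose_same
      (evolution N β * ((1 : Matrix (ZMod N) (ZMod N) ℂ) ⊗ₖ kraus p n))
    rwa [Matrix.conjTranspose_mul, ← mul_assoc] at this

theorem posSemidef_walkerDensity (t : ℕ) : (walkerDensity N β p ψ₀ t).PosSemidef := by
  have : walkerDensity N β p ψ₀ t =
      ∑ j : Fin 2, (density N β p ψ₀ t).submatrix (fun x => (x, j)) (fun x => (x, j)) := by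
    ext x y
    simp [walkerDensity]
  rw [this]
  exact Matrix.posSemidef_sum _ fun j _ => (posSemidef_density t).submatrix _

theorem posSemidef_coinDensity (t : ℕ) : (coinDensity N β p ψ₀ t).PosSemidef := by
  have : coinDensity N β p ψ₀ t =
      ∑ x : ZMod N, (density N β p ψ₀ t).submatrix (fun j => (x, j)) (fun j => (x, j)) := by
    ext j l
    simp [coinDensity, Matrix.sum_apply]
  rw [this]
  exact Matrix.posSemidef_sum _ fun x _ => (posSemidef_density t).submatrix _

theorem walkerDensity_apply (t : ℕ) (x y : ZMod N) : walkerDensity N β p ψ₀ t x y =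
    density N β p ψ₀ t (x, 0) (y, 0) + density N β p ψ₀ t (x, 1) (y, 1) := by
  simp [walkerDensity]

/-- The sum of the walker's density operator along each of its cyclic diagonals is conserved;
initially it vanishes off the main diagonal. -/
theorem sum_walkerDensity_add (hp0 : 0 ≤ p) (hp1 : p ≤ 1) (hψ₀ : ‖ψ₀‖ = 1) (t : ℕ) (d : ZMod N) :
    ∑ x, walkerDensity N β p ψ₀ t x (x + d) = if d = 0 then 1 else 0 := by
  induction t with
  | zero =>
    have h : (ψ₀ 0 * star (ψ₀ 0) + ψ₀ 1 * star (ψ₀ 1) : ℂ) = 1 := by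
      have h2 := EuclideanSpace.norm_sq_eq ψ₀
      rw [hψ₀, Fin.sum_univ_two] at h2
      simp only [Complex.star_def, Complex.mul_conj, Complex.normSq_eq_norm_sq]
      exact_mod_cast (by simpa using h2.symm)
    rw [Finset.sum_eq_single 0]
    · by_cases hd : d = 0
      · subst hd
        simpa [walkerDensity_apply, density, initialDensity, Matrix.kroneckerMap_apply] using h
      · simp [walkerDensity_apply, density, initialDensity, Matrix.kroneckerMap_apply, hd,
          Ne.symm hd]
    · intro x _ hx
      simp [walkerDensity_apply, density, initialDensity, Matrix.kroneckerMap_apply, hx.symm]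
    · simp
  | succ t ih =>
    rw [← ih]
    simp only [walkerDensity_apply, Finset.sum_add_distrib]
    rw [← Equiv.sum_comp (Equiv.addRight (1 : ZMod N))
        fun x => density N β p ψ₀ (t + 1) (x, 0) (x + d, 0),
      ← Equiv.sum_comp (Equiv.subRight (1 : ZMod N))
        fun x => density N β p ψ₀ (t + 1) (x, 1) (x + d, 1),
      ← Finset.sum_add_distrib, ← Finset.sum_add_distrib]
    refine Finset.sum_congr rfl fun x _ => ?_
    have hsc : (Real.cos β : ℂ) ^ 2 + (Real.sin β : ℂ) ^ 2 = 1 := by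
      exact_mod_cast Real.cos_sq_add_sin_sq β
    rw [Equiv.coe_addRight, Equiv.subRight_apply, add_right_comm, sub_add_eq_add_sub,
      density_succ_zero_zero hp0 hp1, density_succ_one_one hp0 hp1]
    linear_combination
      (density N β p ψ₀ t (x, 0) (x + d, 0) + density N β p ψ₀ t (x, 1) (x + d, 1)) * hsc

theorem walkerDensity_mem_states (hp0 : 0 ≤ p) (hp1 : p ≤ 1) (hψ₀ : ‖ψ₀‖ = 1) (t : ℕ) :
    walkerDensity N β p ψ₀ t ∈ states (ZMod N) :=
  ⟨posSemidef_walkerDensity t, by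
    simpa [Matrix.trace] using sum_walkerDensity_add (N := N) (β := β) hp0 hp1 hψ₀ t 0⟩

theorem trace_coinDensity (t : ℕ) :
    (coinDensity N β p ψ₀ t).trace = (walkerDensity N β p ψ₀ t).trace := by
  simp only [Matrix.trace, Matrix.diag_apply, coinDensity, walkerDensity, Matrix.of_apply]
  exact Finset.sum_comm

theorem coinDensity_mem_states (hp0 : 0 ≤ p) (hp1 : p ≤ 1) (hψ₀ : ‖ψ₀‖ = 1) (t : ℕ) :
    coinDensity N β p ψ₀ t ∈ states (Fin 2) :=
  ⟨posSemidef_coinDensity t, by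
    rw [trace_coinDensity]; exact (walkerDensity_mem_states hp0 hp1 hψ₀ t).2⟩

end Conserved

/-! ### Loss of purity and its consequences -/

section Decay

variable {N : ℕ} [NeZero N] {β p : ℝ} {ψ₀ : EuclideanSpace ℂ (Fin 2)}

/-- Conjugating the `2 × 2` matrix with entries `A`, `q B`, `q D`, `E` by the coin preserves the
Hilbert-Schmidt norm. -/
theorem norm_sq_conj_coin {c s : ℝ} (h : c ^ 2 + s ^ 2 = 1) (q : ℝ) (A B D E : ℂ) :
    ‖c ^ 2 * A + c * s * q * (B + D) + s ^ 2 * E‖ ^ 2 +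
      ‖c * s * (A - E) - c ^ 2 * q * B + s ^ 2 * q * D‖ ^ 2 +
      (‖c * s * (A - E) + s ^ 2 * q * B - c ^ 2 * q * D‖ ^ 2 +
      ‖s ^ 2 * A - c * s * q * (B + D) + c ^ 2 * E‖ ^ 2) =
    ‖A‖ ^ 2 + q ^ 2 * ‖B‖ ^ 2 + (q ^ 2 * ‖D‖ ^ 2 + ‖E‖ ^ 2) := by
  simp only [← Complex.normSq_eq_norm_sq]
  apply Complex.ofReal_injective
  have h' : (c : ℂ) ^ 2 + (s : ℂ) ^ 2 = 1 := by exact_mod_cast h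
  push_cast
  simp only [← Complex.mul_conj, map_add, map_sub, map_mul, map_pow, Complex.conj_ofReal]
  linear_combination ((c : ℂ) ^ 2 + (s : ℂ) ^ 2 + 1) * (A * (starRingEnd ℂ) A +
    E * (starRingEnd ℂ) E + q ^ 2 * (B * (starRingEnd ℂ) B + D * (starRingEnd ℂ) D)) * h'

/-- The blocks of the purity may be summed over nodes translated according to the coin states. -/
theorem purity_eq_sum_blocks (ρ : Matrix (ZMod N × Fin 2) (ZMod N × Fin 2) ℂ)
    (u : Fin 2 → ZMod N) :
    purity ρ = ∑ x, ∑ y, (‖ρ (x + u 0, 0) (y + u 0, 0)‖ ^ 2 +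
      ‖ρ (x + u 0, 0) (y + u 1, 1)‖ ^ 2 + (‖ρ (x + u 1, 1) (y + u 0, 0)‖ ^ 2 +
      ‖ρ (x + u 1, 1) (y + u 1, 1)‖ ^ 2)) := by
  have key : ∀ j l : Fin 2, ∑ x, ∑ y, ‖ρ (x + u j, j) (y + u l, l)‖ ^ 2 =
      ∑ x, ∑ y, ‖ρ (x, j) (y, l)‖ ^ 2 := fun j l => by
    rw [← Equiv.sum_comp (Equiv.addRight (u j)) fun x => ∑ y, ‖ρ (x, j) (y, l)‖ ^ 2]
    refine Finset.sum_congr rfl fun x _ => ?_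
    exact Equiv.sum_comp (Equiv.addRight (u l)) fun y => ‖ρ (x + u j, j) (y, l)‖ ^ 2
  simp only [Finset.sum_add_distrib, key]
  simp only [purity, Fintype.sum_prod_type, Fin.sum_univ_two, Finset.sum_add_distrib]
  exact add_add_add_comm _ _ _ _

/-- One step of the walk lowers the purity in proportion to the weight of the coin-off-diagonal
blocks: the evolution is unitary, and the decoherence shrinks exactly these blocks. -/
theorem purity_density_succ (hp0 : 0 ≤ p) (hp1 : p ≤ 1) (t : ℕ) :
    purity (density N β p ψ₀ (t + 1)) = purity (density N β p ψ₀ t) - p * (2 - p) *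
      ∑ x, ∑ y, (‖density N β p ψ₀ t (x, 0) (y, 1)‖ ^ 2 +
        ‖density N β p ψ₀ t (x, 1) (y, 0)‖ ^ 2) := by
  rw [purity_eq_sum_blocks _ (step N), purity_eq_sum_blocks (density N β p ψ₀ t) 0, Finset.mul_sum,
    ← Finset.sum_sub_distrib]
  refine Finset.sum_congr rfl fun x _ => ?_
  rw [Finset.mul_sum, ← Finset.sum_sub_distrib]
  refine Finset.sum_congr rfl fun y _ => ?_
  have h := norm_sq_conj_coin (Real.cos_sq_add_sin_sq β) (1 - p)
    (density N β p ψ₀ t (x, 0) (y, 0)) (density N β p ψ₀ t (x, 0) (y, 1))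
    (density N β p ψ₀ t (x, 1) (y, 0)) (density N β p ψ₀ t (x, 1) (y, 1))
  rw [Complex.ofReal_sub, Complex.ofReal_one] at h
  simp only [step, if_true, one_ne_zero, if_false, ← sub_eq_add_neg, Pi.zero_apply, add_zero]
  rw [density_succ_zero_zero hp0 hp1, density_succ_zero_one hp0 hp1,
    density_succ_one_zero hp0 hp1, density_succ_one_one hp0 hp1, h]
  ring

/-- The purity decreases and is bounded below, so its decrements tend to zero. -/
theorem tendsto_offDiag_sum (hp0 : 0 < p) (hp1 : p ≤ 1) :
    Tendsto (fun t => ∑ x, ∑ y, (‖density N β p ψ₀ t (x, 0) (y, 1)‖ ^ 2 +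
        ‖density N β p ψ₀ t (x, 1) (y, 0)‖ ^ 2)) atTop (𝓝 0) := by
  have hc : 0 < p * (2 - p) := mul_pos hp0 (by linarith)
  have hanti : Antitone fun t => purity (density N β p ψ₀ t) :=
    antitone_nat_of_succ_le fun t => by
      rw [purity_density_succ hp0.le hp1]
      exact sub_le_self _ (mul_nonneg hc.le (by positivity))
  have hbdd : BddBelow (range fun t => purity (density N β p ψ₀ t)) :=
    ⟨0, by rintro _ ⟨t, rfl⟩; exact Finset.sum_nonneg fun _ _ => by positivity⟩
  have hlim := tendsto_atTop_ciInf hanti hbdd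
  have hdiff := (hlim.sub ((tendsto_add_atTop_iff_nat 1).2 hlim)).const_mul (p * (2 - p))⁻¹
  rw [sub_self, mul_zero] at hdiff
  refine hdiff.congr fun t => ?_
  rw [purity_density_succ hp0.le hp1, sub_sub_cancel, inv_mul_cancel_left₀ hc.ne']

theorem tendsto_offDiag (hp0 : 0 < p) (hp1 : p ≤ 1) (x y : ZMod N) :
    Tendsto (fun t => density N β p ψ₀ t (x, 0) (y, 1)) atTop (𝓝 0) ∧
      Tendsto (fun t => density N β p ψ₀ t (x, 1) (y, 0)) atTop (𝓝 0) := by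
  have hle : ∀ t, ‖density N β p ψ₀ t (x, 0) (y, 1)‖ ^ 2 +
      ‖density N β p ψ₀ t (x, 1) (y, 0)‖ ^ 2 ≤
      ∑ x, ∑ y, (‖density N β p ψ₀ t (x, 0) (y, 1)‖ ^ 2 +
        ‖density N β p ψ₀ t (x, 1) (y, 0)‖ ^ 2) := fun t =>
    (Finset.single_le_sum (f := fun y => ‖density N β p ψ₀ t (x, 0) (y, 1)‖ ^ 2 +
      ‖density N β p ψ₀ t (x, 1) (y, 0)‖ ^ 2) (fun _ _ => by positivity)
      (Finset.mem_univ y)).trans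
    (Finset.single_le_sum (f := fun x => ∑ y, (‖density N β p ψ₀ t (x, 0) (y, 1)‖ ^ 2 +
      ‖density N β p ψ₀ t (x, 1) (y, 0)‖ ^ 2)) (fun _ _ => by positivity) (Finset.mem_univ x))
  have aux : ∀ f : ℕ → ℂ, (∀ t, ‖f t‖ ^ 2 ≤ ∑ x, ∑ y,
      (‖density N β p ψ₀ t (x, 0) (y, 1)‖ ^ 2 + ‖density N β p ψ₀ t (x, 1) (y, 0)‖ ^ 2)) →
      Tendsto f atTop (𝓝 0) := fun f hf => by
    have h := (squeeze_zero (fun t => sq_nonneg _) hf (tendsto_offDiag_sum hp0 hp1)).sqrt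
    rw [Real.sqrt_zero] at h
    exact tendsto_zero_iff_norm_tendsto_zero.2 (h.congr fun t => Real.sqrt_sq (norm_nonneg _))
  exact ⟨aux _ fun t => (le_add_of_nonneg_right (sq_nonneg _)).trans (hle t),
    aux _ fun t => (le_add_of_nonneg_left (sq_nonneg _)).trans (hle t)⟩

/-- The two coin-diagonal blocks merge: their difference is fed by the evolution, with the nonzero
factor `cos β sin β`, into the coin-off-diagonal block of the next step. -/
theorem tendsto_diag_sub (hβ : β ∈ Set.Ioo 0 (Real.pi / 2)) (hp0 : 0 < p) (hp1 : p ≤ 1)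
    (x y : ZMod N) :
    Tendsto (fun t => density N β p ψ₀ t (x, 0) (y, 0) - density N β p ψ₀ t (x, 1) (y, 1))
      atTop (𝓝 0) := by
  have hcs : (Real.cos β * Real.sin β : ℂ) ≠ 0 := by
    have h1 := Real.cos_pos_of_mem_Ioo ⟨by linarith [hβ.1, Real.pi_pos], hβ.2⟩
    have h2 := Real.sin_pos_of_pos_of_lt_pi hβ.1 (by linarith [hβ.2, Real.pi_pos])
    exact_mod_cast (mul_pos h1 h2).ne'
  obtain ⟨h01, h10⟩ := tendsto_offDiag (β := β) (ψ₀ := ψ₀) hp0 hp1 x y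
  have h' := (tendsto_add_atTop_iff_nat 1).2
    (tendsto_offDiag (β := β) (ψ₀ := ψ₀) hp0 hp1 (x + 1) (y - 1)).1
  have h := ((h'.add (h01.const_mul (Real.cos β ^ 2 * (1 - p) : ℂ))).sub
    (h10.const_mul (Real.sin β ^ 2 * (1 - p) : ℂ))).const_mul (Real.cos β * Real.sin β : ℂ)⁻¹
  simp only [mul_zero, add_zero, sub_zero] at h
  refine h.congr fun t => ?_
  rw [density_succ_zero_one hp0.le hp1, inv_mul_eq_iff_eq_mul₀ hcs]
  ring

/-- The walker's density operator becomes invariant under translation by `2`: its two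
contributions to the next step, moved forward and backward, have to agree asymptotically. -/
theorem tendsto_walkerDensity_sub (hβ : β ∈ Set.Ioo 0 (Real.pi / 2)) (hp0 : 0 < p) (hp1 : p ≤ 1)
    (x y : ZMod N) :
    Tendsto (fun t => walkerDensity N β p ψ₀ t x y - walkerDensity N β p ψ₀ t (x + 2) (y + 2))
      atTop (𝓝 0) := by
  have hoff : ∀ x y : ZMod N, Tendsto (fun t => 2 * (Real.cos β * Real.sin β * (1 - p) : ℂ) *
      (density N β p ψ₀ t (x, 0) (y, 1) + density N β p ψ₀ t (x, 1) (y, 0))) atTop (𝓝 0) :=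
    fun x y => by
      simpa using ((tendsto_offDiag hp0 hp1 x y).1.add
        (tendsto_offDiag (β := β) (ψ₀ := ψ₀) hp0 hp1 x y).2).const_mul
          (2 * (Real.cos β * Real.sin β * (1 - p) : ℂ))
  have hdiff : ∀ x y : ZMod N, Tendsto (fun t => (Real.cos β ^ 2 - Real.sin β ^ 2 : ℂ) *
      (density N β p ψ₀ t (x, 0) (y, 0) - density N β p ψ₀ t (x, 1) (y, 1))) atTop (𝓝 0) :=
    fun x y => by
      simpa using (tendsto_diag_sub (ψ₀ := ψ₀) hβ hp0 hp1 x y).const_mul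
        (Real.cos β ^ 2 - Real.sin β ^ 2 : ℂ)
  have h' := ((tendsto_add_atTop_iff_nat 1).2
    (tendsto_diag_sub (ψ₀ := ψ₀) hβ hp0 hp1 (x + 1) (y + 1))).const_mul (2 : ℂ)
  have h := ((h'.sub ((hdiff x y).add (hdiff (x + 2) (y + 2)))).sub (hoff x y)).sub
    (hoff (x + 2) (y + 2))
  simp only [mul_zero, add_zero, sub_zero] at h
  refine h.congr fun t => ?_
  have hsc : (Real.cos β : ℂ) ^ 2 + (Real.sin β : ℂ) ^ 2 = 1 := by
    exact_mod_cast Real.cos_sq_add_sin_sq β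
  have e := density_succ_one_one (β := β) (ψ₀ := ψ₀) hp0.le hp1 t (x + 2) (y + 2)
  rw [show x + 2 - 1 = x + 1 by ring, show y + 2 - 1 = y + 1 by ring] at e
  rw [density_succ_zero_zero hp0.le hp1, e, walkerDensity_apply, walkerDensity_apply]
  linear_combination (density N β p ψ₀ t (x, 0) (y, 0) + density N β p ψ₀ t (x, 1) (y, 1) -
    density N β p ψ₀ t (x + 2, 0) (y + 2, 0) - density N β p ψ₀ t (x + 2, 1) (y + 2, 1)) * hsc

theorem tendsto_walkerDensity_sub_nat (hβ : β ∈ Set.Ioo 0 (Real.pi / 2)) (hp0 : 0 < p)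
    (hp1 : p ≤ 1) (x y : ZMod N) (k : ℕ) :
    Tendsto (fun t => walkerDensity N β p ψ₀ t x y -
      walkerDensity N β p ψ₀ t (x + 2 * k) (y + 2 * k)) atTop (𝓝 0) := by
  induction k with
  | zero => simp
  | succ k ih =>
    have h := ih.add (tendsto_walkerDensity_sub (ψ₀ := ψ₀) hβ hp0 hp1
      (x + 2 * (k : ZMod N)) (y + 2 * (k : ZMod N)))
    rw [add_zero] at h
    refine h.congr fun t => ?_
    rw [sub_add_sub_cancel, Nat.cast_succ, mul_add_one, ← add_assoc, ← add_assoc]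

/-- On a set `C` of translates of `x` by even amounts, averaging along the cyclic diagonal through
`(x, y)` does not change the entry at `(x, y)` asymptotically. -/
theorem tendsto_card_mul_sub_sum (hβ : β ∈ Set.Ioo 0 (Real.pi / 2)) (hp0 : 0 < p) (hp1 : p ≤ 1)
    (x y : ZMod N) (C : Finset (ZMod N)) (hC : ∀ z ∈ C, ∃ k : ℕ, z = x + 2 * k) :
    Tendsto (fun t => C.card * walkerDensity N β p ψ₀ t x y -
      ∑ z ∈ C, walkerDensity N β p ψ₀ t z (z + (y - x))) atTop (𝓝 0) := by
  have h := tendsto_finsetSum C (f := fun z t => walkerDensity N β p ψ₀ t x y -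
    walkerDensity N β p ψ₀ t z (z + (y - x))) (a := fun _ => 0) (x := atTop) fun z hz => by
      obtain ⟨k, rfl⟩ := hC z hz
      have e : x + 2 * k + (y - x) = y + 2 * (k : ZMod N) := by ring
      rw [e]
      exact tendsto_walkerDensity_sub_nat hβ hp0 hp1 x y k
  simpa using h

end Decay

/-! ### The entropies of the coin and of the walker -/

section Limits

variable {N : ℕ} [NeZero N] {β p : ℝ} {ψ₀ : EuclideanSpace ℂ (Fin 2)}

theorem tendsto_entropy_coinDensity (hβ : β ∈ Set.Ioo 0 (Real.pi / 2)) (hp0 : 0 < p) (hp1 : p ≤ 1)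
    (hψ₀ : ‖ψ₀‖ = 1) {b : ℝ} (hb : 1 < b) :
    Tendsto (fun t => entropy b (coinDensity N β p ψ₀ t)) atTop (𝓝 (Real.logb b 2)) := by
  have hst := fun t => coinDensity_mem_states (N := N) (β := β) hp0.le hp1 hψ₀ t
  have h01 : Tendsto (fun t => coinDensity N β p ψ₀ t 0 1) atTop (𝓝 0) := by
    simpa [coinDensity] using tendsto_finsetSum Finset.univ fun (x : ZMod N) _ =>
      (tendsto_offDiag (β := β) (ψ₀ := ψ₀) hp0 hp1 x x).1
  have h10 : Tendsto (fun t => coinDensity N β p ψ₀ t 1 0) atTop (𝓝 0) := by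
    simpa [coinDensity] using tendsto_finsetSum Finset.univ fun (x : ZMod N) _ =>
      (tendsto_offDiag (β := β) (ψ₀ := ψ₀) hp0 hp1 x x).2
  have hd : Tendsto (fun t => coinDensity N β p ψ₀ t 0 0 - coinDensity N β p ψ₀ t 1 1)
      atTop (𝓝 0) := by
    simpa [coinDensity] using tendsto_finsetSum Finset.univ fun (x : ZMod N) _ =>
      (tendsto_diag_sub (ψ₀ := ψ₀) hβ hp0 hp1 x x)
  have htr : ∀ t, coinDensity N β p ψ₀ t 0 0 + coinDensity N β p ψ₀ t 1 1 = 1 := fun t => by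
    simpa [Matrix.trace_fin_two] using (hst t).2
  refine tendsto_entropy hb two_pos hst
    (fun t => by exact_mod_cast Matrix.rank_le_card_width (coinDensity N β p ψ₀ t))
    fun j l => tendsto_mul_of_states hst j l ?_
  fin_cases j <;> fin_cases l
  · refine hd.congr fun t => ?_
    simp only [Fin.zero_eta, if_true, Complex.ofReal_ofNat]
    linear_combination -htr t
  · simpa using h01.const_mul (2 : ℂ)
  · simpa using h10.const_mul (2 : ℂ)
  · have h := hd.neg
    rw [neg_zero] at h
    refine h.congr fun t => ?_
    simp only [Fin.mk_one, if_true, Complex.ofReal_ofNat]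
    linear_combination -htr t

theorem tendsto_entropy_walkerDensity_of_odd (hβ : β ∈ Set.Ioo 0 (Real.pi / 2)) (hp0 : 0 < p)
    (hp1 : p ≤ 1) (hψ₀ : ‖ψ₀‖ = 1) (hN : Odd N) {b : ℝ} (hb : 1 < b) :
    Tendsto (fun t => entropy b (walkerDensity N β p ψ₀ t)) atTop (𝓝 (Real.logb b N)) := by
  have hst := fun t => walkerDensity_mem_states (N := N) (β := β) hp0.le hp1 hψ₀ t
  have hN0 : (0 : ℝ) < N := by exact_mod_cast Nat.pos_of_neZero N
  refine tendsto_entropy hb hN0 hst (fun t => ?_) fun x y => tendsto_mul_of_states hst x y ?_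
  · have := Matrix.rank_le_card_width (walkerDensity N β p ψ₀ t)
    rw [ZMod.card] at this
    exact_mod_cast this
  · refine (tendsto_card_mul_sub_sum (ψ₀ := ψ₀) hβ hp0 hp1 x y Finset.univ
      fun z _ => ?_).congr fun t => ?_
    · refine ⟨((2 : ZMod N)⁻¹ * (z - x)).val, ?_⟩
      have h2 : (2 : ZMod N) * (2 : ZMod N)⁻¹ = 1 :=
        mod_cast ZMod.coe_mul_inv_eq_one 2 (Nat.coprime_two_left.2 hN)
      rw [ZMod.natCast_val, ZMod.cast_id', id, ← mul_assoc, h2]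
      ring
    · rw [sum_walkerDensity_add hp0.le hp1 hψ₀, Finset.card_univ, ZMod.card]
      simp [sub_eq_zero, eq_comm]

end Limits

/-! ### Parity on an even cycle -/

section Parity

variable {N : ℕ} [NeZero N] {β p : ℝ} {ψ₀ : EuclideanSpace ℂ (Fin 2)}

/-- The nodes `x` with `t - x` even, which on an even cycle are the only ones the walker can occupy
at time `t`. -/
def parityNodes (N : ℕ) [NeZero N] (t : ℕ) : Finset (ZMod N) :=
  Finset.univ.filter fun x => Even ((t : ℤ) - x.val)

theorem mem_parityNodes_iff (h2 : 2 ∣ N) (t : ℕ) (x : ZMod N) :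
    x ∈ parityNodes N t ↔ ZMod.castHom h2 (ZMod 2) x = t := by
  have h : ZMod.castHom h2 (ZMod 2) x = (x.val : ZMod 2) := by
    rw [ZMod.castHom_apply, ZMod.natCast_val]
  rw [h, parityNodes, Finset.mem_filter, even_iff_two_dvd,
    ← Nat.cast_two (R := ℤ), ← ZMod.intCast_eq_intCast_iff_dvd_sub]
  simp

theorem two_mul_card_parityNodes (h2 : 2 ∣ N) (t : ℕ) : 2 * (parityNodes N t).card = N := by
  have hsucc : (parityNodes N (t + 1)).card = (parityNodes N t).card := by
    refine (Finset.card_bij (fun x _ => x + 1) (fun x hx => ?_)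
      (fun x _ y _ h => add_right_cancel h) fun y hy => ⟨y - 1, ?_, sub_add_cancel _ _⟩).symm
    · rw [mem_parityNodes_iff h2] at hx ⊢
      rw [map_add, hx, map_one, Nat.cast_succ]
    · rw [mem_parityNodes_iff h2] at hy ⊢
      rw [map_sub, hy, map_one, Nat.cast_succ, add_sub_cancel_right]
  have hcompl : parityNodes N (t + 1) = (parityNodes N t)ᶜ := by
    ext x
    rw [Finset.mem_compl, mem_parityNodes_iff h2, mem_parityNodes_iff h2, Nat.cast_succ]
    generalize ZMod.castHom h2 (ZMod 2) x = u
    generalize (t : ZMod 2) = v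
    revert u v
    decide
  have h := Finset.card_add_card_compl (parityNodes N t)
  rw [← hcompl, hsucc, ZMod.card] at h
  omega

theorem parityNodes_nonempty (h2 : 2 ∣ N) (t : ℕ) : (parityNodes N t).Nonempty := by
  have := two_mul_card_parityNodes h2 t
  have := Nat.pos_of_neZero N
  exact Finset.card_pos.1 (by omega)

theorem card_parityNodes (h2 : 2 ∣ N) (t : ℕ) : ((parityNodes N t).card : ℝ) = N / 2 := by
  have : (2 * (parityNodes N t).card : ℝ) = N := by exact_mod_cast two_mul_card_parityNodes h2 t
  linarith

theorem mem_parityStates_iff (t : ℕ) (σ : Matrix (ZMod N) (ZMod N) ℂ) :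
    σ ∈ parityStates N t ↔ σ ∈ states (ZMod N) ∧
      ∀ x y, ¬ (x ∈ parityNodes N t ∧ y ∈ parityNodes N t) → σ x y = 0 := by
  simp [parityStates, parityNodes]

theorem density_eq_zero_of_parity (h2 : 2 ∣ N) (hp0 : 0 ≤ p) (hp1 : p ≤ 1) (t : ℕ) (x y : ZMod N)
    (j l : Fin 2) (h : ¬ (x ∈ parityNodes N t ∧ y ∈ parityNodes N t)) :
    density N β p ψ₀ t (x, j) (y, l) = 0 := by
  induction t generalizing x y j l with
  | zero =>
    by_cases hx : 0 = x
    · by_cases hy : 0 = y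
      · exact absurd (by subst hx; subst hy; simp [mem_parityNodes_iff h2]) h
      · simp [density, initialDensity, Matrix.kroneckerMap_apply, hy]
    · simp [density, initialDensity, Matrix.kroneckerMap_apply, hx]
  | succ t ih =>
    -- Modulo 2 the displacement is `1`, whatever the state of the coin.
    have hstep : ∀ (z : ZMod N) (j : Fin 2), z - step N j ∈ parityNodes N t →
        z ∈ parityNodes N (t + 1) := fun z j hz => by
      rw [mem_parityNodes_iff h2] at hz ⊢
      have hs : ZMod.castHom h2 (ZMod 2) (step N j) = 1 := by
        rw [step]
        split_ifs
        · exact map_one _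
        · rw [map_neg, map_one]; decide
      rw [map_sub, hs, sub_eq_iff_eq_add] at hz
      rw [hz, Nat.cast_succ]
    rw [density_succ_apply hp0 hp1]
    refine Finset.sum_eq_zero fun a _ => Finset.sum_eq_zero fun b _ => ?_
    rw [ih _ _ _ _ fun hxy => h ⟨hstep x j hxy.1, hstep y l hxy.2⟩, mul_zero]

theorem walkerDensity_eq_zero_of_parity (h2 : 2 ∣ N) (hp0 : 0 ≤ p) (hp1 : p ≤ 1) (t : ℕ)
    (x y : ZMod N) (h : ¬ (x ∈ parityNodes N t ∧ y ∈ parityNodes N t)) :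
    walkerDensity N β p ψ₀ t x y = 0 := by
  rw [walkerDensity_apply, density_eq_zero_of_parity h2 hp0 hp1 t x y 0 0 h,
    density_eq_zero_of_parity h2 hp0 hp1 t x y 1 1 h, add_zero]

theorem walkerDensity_mem_parityStates (h2 : 2 ∣ N) (hp0 : 0 ≤ p) (hp1 : p ≤ 1)
    (hψ₀ : ‖ψ₀‖ = 1) (t : ℕ) : walkerDensity N β p ψ₀ t ∈ parityStates N t :=
  (mem_parityStates_iff t _).2 ⟨walkerDensity_mem_states hp0 hp1 hψ₀ t,
    walkerDensity_eq_zero_of_parity h2 hp0 hp1 t⟩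

theorem tendsto_entropy_walkerDensity_of_even (hβ : β ∈ Set.Ioo 0 (Real.pi / 2)) (hp0 : 0 < p)
    (hp1 : p ≤ 1) (hψ₀ : ‖ψ₀‖ = 1) (h2 : 2 ∣ N) {b : ℝ} (hb : 1 < b) :
    Tendsto (fun t => entropy b (walkerDensity N β p ψ₀ t)) atTop
      (𝓝 (Real.logb b ((N : ℝ) / 2))) := by
  have hst := fun t => walkerDensity_mem_states (N := N) (β := β) hp0.le hp1 hψ₀ t
  have hzero := fun t => walkerDensity_eq_zero_of_parity (β := β) (ψ₀ := ψ₀) h2 hp0.le hp1 t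
  have hN0 : (0 : ℝ) < N / 2 := by
    have : (0 : ℝ) < N := by exact_mod_cast Nat.pos_of_neZero N
    positivity
  refine tendsto_entropy hb hN0 hst (fun t => ?_) fun x y => ?_
  · rw [← card_parityNodes h2 t]
    exact_mod_cast rank_le_card_of_apply_eq_zero _ fun x y hx => hzero t x y fun h => hx h.1
  -- The nodes of the parity of `x` are its even translates. At a time of the other parity the
  -- prefactor vanishes; at a time of this parity they carry the whole of each cyclic diagonal.
  · have hC : ∀ z ∈ parityNodes N x.val, ∃ k : ℕ, z = x + 2 * k := fun z hz => by
      have hx : x ∈ parityNodes N x.val := by simp [parityNodes]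
      rw [mem_parityNodes_iff h2] at hz hx
      have h0 : z - x ∈ parityNodes N 0 := by
        rw [mem_parityNodes_iff h2, map_sub, hz, hx, sub_self, Nat.cast_zero]
      have he : Even (z - x).val := by
        have h1 := (Finset.mem_filter.1 h0).2
        rwa [Nat.cast_zero, zero_sub, even_neg, Int.even_coe_nat] at h1
      obtain ⟨k, hk⟩ := he.two_dvd
      refine ⟨k, ?_⟩
      have e := ZMod.natCast_zmod_val (z - x)
      rw [hk, Nat.cast_mul, Nat.cast_two] at e
      rw [e, add_sub_cancel]
    refine (tendsto_mul_of_states hst x y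
      (tendsto_card_mul_sub_sum (ψ₀ := ψ₀) hβ hp0 hp1 x y _ hC)).congr fun t => ?_
    by_cases hxt : x ∈ parityNodes N t
    · have hset : parityNodes N x.val = parityNodes N t := by
        have hx : x ∈ parityNodes N x.val := by simp [parityNodes]
        rw [mem_parityNodes_iff h2] at hxt hx
        ext z
        rw [mem_parityNodes_iff h2, mem_parityNodes_iff h2, ← hx, hxt]
      have hsum : ∑ z ∈ parityNodes N t, walkerDensity N β p ψ₀ t z (z + (y - x)) =
          if x = y then 1 else 0 := by
        rw [Finset.sum_subset (Finset.subset_univ _) fun z _ hz =>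
          hzero t z _ fun h => hz h.1, sum_walkerDensity_add hp0.le hp1 hψ₀]
        simp [sub_eq_zero, eq_comm]
      rw [hset, hsum, ← card_parityNodes h2 t, Complex.ofReal_natCast]
    · rw [hzero t x y fun h => hxt h.1, zero_mul, zero_mul]

end Parity

end CycleWalk

theorem corollary2 (N : ℕ) [NeZero N] (β p : ℝ) (hβ : β ∈ Set.Ioo 0 (Real.pi / 2))
    (hp0 : 0 < p) (hp1 : p ≤ 1) (ψ₀ : EuclideanSpace ℂ (Fin 2)) (hψ₀ : ‖ψ₀‖ = 1) :
    -- limits, the coin's entropy in bits and the walker's entropy in natural units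
    (Tendsto (fun t => CycleWalk.entropy 2 (CycleWalk.coinDensity N β p ψ₀ t)) atTop (𝓝 1) ∧
      (Odd N → Tendsto
        (fun t => CycleWalk.entropy (Real.exp 1) (CycleWalk.walkerDensity N β p ψ₀ t))
        atTop (𝓝 (Real.log N))) ∧
      (Even N → Tendsto
        (fun t => CycleWalk.entropy (Real.exp 1) (CycleWalk.walkerDensity N β p ψ₀ t))
        atTop (𝓝 (Real.log ((N : ℝ) / 2))))) ∧
    -- the reduced density operators are states of the subsystems
    (∀ t, CycleWalk.coinDensity N β p ψ₀ t ∈ CycleWalk.states (Fin 2)) ∧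
    (∀ t, CycleWalk.walkerDensity N β p ψ₀ t ∈ CycleWalk.states (ZMod N)) ∧
    (Even N → ∀ t, CycleWalk.walkerDensity N β p ψ₀ t ∈ CycleWalk.parityStates N t) ∧
    -- in every base the limits are the maximal values of the entropy
    ∀ b : ℝ, 1 < b →
      (Tendsto (fun t => CycleWalk.entropy b (CycleWalk.coinDensity N β p ψ₀ t)) atTop
          (𝓝 (Real.logb b 2)) ∧
        IsGreatest (CycleWalk.entropy b '' CycleWalk.states (Fin 2)) (Real.logb b 2)) ∧
      (Odd N →
        Tendsto (fun t => CycleWalk.entropy b (CycleWalk.walkerDensity N β p ψ₀ t)) atTop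
          (𝓝 (Real.logb b N)) ∧
        IsGreatest (CycleWalk.entropy b '' CycleWalk.states (ZMod N)) (Real.logb b N)) ∧
      (Even N →
        Tendsto (fun t => CycleWalk.entropy b (CycleWalk.walkerDensity N β p ψ₀ t)) atTop
          (𝓝 (Real.logb b ((N : ℝ) / 2))) ∧
        ∀ t, IsGreatest (CycleWalk.entropy b '' CycleWalk.parityStates N t)
          (Real.logb b ((N : ℝ) / 2))) := by
  have hcoin := fun b hb => CycleWalk.tendsto_entropy_coinDensity (N := N) hβ hp0 hp1 hψ₀
    (b := b) hb
  have hodd := fun hN b hb =>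
    CycleWalk.tendsto_entropy_walkerDensity_of_odd (N := N) hβ hp0 hp1 hψ₀ hN (b := b) hb
  have heven := fun (hN : Even N) b hb =>
    CycleWalk.tendsto_entropy_walkerDensity_of_even hβ hp0 hp1 hψ₀ hN.two_dvd (b := b) hb
  have he : 1 < Real.exp 1 := Real.one_lt_exp_iff.2 one_pos
  have hlog : ∀ x, Real.logb (Real.exp 1) x = Real.log x := fun x => by
    rw [Real.logb, Real.log_exp, div_one]
  refine ⟨⟨?_, fun hN => ?_, fun hN => ?_⟩, CycleWalk.coinDensity_mem_states hp0.le hp1 hψ₀,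
    CycleWalk.walkerDensity_mem_states hp0.le hp1 hψ₀,
    fun hN => CycleWalk.walkerDensity_mem_parityStates hN.two_dvd hp0.le hp1 hψ₀,
    fun b hb => ⟨⟨hcoin b hb, ?_⟩, fun hN => ⟨hodd hN b hb, ?_⟩,
      fun hN => ⟨heven hN b hb, fun t => ?_⟩⟩⟩
  · simpa [Real.logb_self_eq_one one_lt_two] using hcoin 2 one_lt_two
  · rw [← hlog]; exact hodd hN _ he
  · rw [← hlog]; exact heven hN _ he
  · simpa using CycleWalk.isGreatest_entropy_states (n := Fin 2) hb
  · simpa using CycleWalk.isGreatest_entropy_states (n := ZMod N) hb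
  · rw [← CycleWalk.card_parityNodes hN.two_dvd t]
    exact CycleWalk.isGreatest_entropy_supported hb
      (CycleWalk.parityNodes_nonempty hN.two_dvd t) (CycleWalk.mem_parityStates_iff t)
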